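/- Let $\mathcal H$ be a separable complex Hilbert space. For a bounded positive operator $A$ on $\mathcal H$ put $\operatorname{tr}(A)=\sum_j\langle Ae_j,e_j\rangle\in[0,\infty]$, where $(e_j)$ is any orthonormal basis of $\mathcal H$. For $1\le p<\infty$ and a bounded operator $X$ let $|X|=(X^*X)^{1/2}$ and $\|X\|_p=[\operatorname{tr}(|X|^p)]^{1/p}\in[0,\infty]$; the Schatten class $\mathfrak C_p(\mathcal H)$ is the set of compact operators $X$ with $\|X\|_p<\infty$. Put $\operatorname{Re}X=\frac12(X+X^*)$ and $\omega_p(X)=\sup_{\theta\in\mathbb R}\|\operatorname{Re}(e^{i\theta}X)\|_p$. For a $d$-tuple $\mathbf T=(T_1,\dots,T_d)$ of bounded operators on $\mathcal H$ let $P=(T_1^*T_1+\cdots+T_d^*T_d)^{1/2}$ and $\|\mathbf T\|_{s,p}=[\operatorname{tr}(P^p)]^{1/p}$; $\mathbf T$ belongs to the spherical Schatten $p$-class $\mathfrak C_p^d(\mathcal H)$ if $\operatorname{tr}(P^p)<\infty$. With $\overline{\mathbb B_d}$ the closed Euclidean unit ball of $\mathbb C^d$, let $$\omega_{s,p}(\mathbf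 T)=\sup_{\lambda\in\overline{\mathbb B_d}}\omega_p(\lambda_1T_1+\cdots+\lambda_dT_d),\qquad \|\mathbf T\|_{s,h,p}=\sup_{\lambda\in\overline{\mathbb B_d}}\|\lambda_1T_1+\cdots+\lambda_dT_d\|_p .$$ Theorem. Let $1\le p<\infty$ and $\mathbf T\in\mathfrak C_p^d(\mathcal H)$. Then $\omega_{s,p}(\mathbf T)$ (the joint Schatten $p$-numerical radius) and $\|\mathbf T\|_{s,h,p}$ (the Schatten hypo-$p$-norm) are well defined: for every $\lambda\in\overline{\mathbb B_d}$ and $\theta\in\mathbb R$ the operators $\lambda_1T_1+\cdots+\lambda_dT_d$ and $\operatorname{Re}[e^{i\theta}(\lambda_1T_1+\cdots+\lambda_dT_d)]$ belong to $\mathfrak C_p(\mathcal H)$, and both suprema are finite. Moreover $$\omega_{s,p}(\mathbf T)\le\|\mathbf T\|_{s,h,p}\le\|\mathbf T\|_{s,p}.$$ -/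

import Mathlib

open scoped InnerProductSpace ENNReal ComplexStarModule

noncomputable section

namespace SchattenTuple

variable {H : Type*} [NormedAddCommGroup H] [InnerProductSpace ℂ H] [CompleteSpace H]

/-- The trace `∑ⱼ ⟪A eⱼ, eⱼ⟫ ∈ [0, ∞]` of a positive operator `A`, computed in some orthonormal basis
of `H`; by `posTrace_eq_tsum` below every orthonormal basis gives the same value. -/
def posTrace (A : H →L[ℂ] H) : ℝ≥0∞ :=
  ∑' j : (exists_hilbertBasis ℂ H).choose,
    ENNReal.ofReal
      (⟪A ((exists_hilbertBasis ℂ H).choose_spec.choose j),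
        (exists_hilbertBasis ℂ H).choose_spec.choose j⟫_ℂ).re

/-- Parseval's identity with values in `[0, ∞]`. -/
lemma tsum_norm_inner_sq {E : Type*} [NormedAddCommGroup E] [InnerProductSpace ℂ E]
    {ι : Type*} (b : HilbertBasis ι ℂ E) (x : E) :
    ∑' i, ENNReal.ofReal (‖⟪b i, x⟫_ℂ‖ ^ 2) = ENNReal.ofReal (‖x‖ ^ 2) := by
  have h := b.hasSum_inner_mul_inner x x
  have h2 : HasSum (fun i => ‖⟪b i, x⟫_ℂ‖ ^ 2) (‖x‖ ^ 2) := by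
    have h3 := Complex.hasSum_re h
    have e1 : (⟪x, x⟫_ℂ).re = ‖x‖ ^ 2 := by
      rw [inner_self_eq_norm_sq_to_K]
      norm_cast
    rw [e1] at h3
    refine h3.congr_fun ?_
    intro i
    rw [← inner_conj_symm x (b i), ← Complex.normSq_eq_conj_mul_self, Complex.ofReal_re,
      Complex.normSq_eq_norm_sq]
  rw [← h2.tsum_eq, ENNReal.ofReal_tsum_of_nonneg (fun i => by positivity) h2.summable]

/-- The trace of a positive operator does not depend on the orthonormal basis. -/
lemma posTrace_eq_tsum {ι : Type*} (b : HilbertBasis ι ℂ H) {A : H →L[ℂ] H} (hA : 0 ≤ A) :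
    posTrace A = ∑' i, ENNReal.ofReal (⟪A (b i), b i⟫_ℂ).re := by
  obtain ⟨S, hS, hSA⟩ : ∃ S : H →L[ℂ] H, IsSelfAdjoint S ∧ S * S = A :=
    ⟨CFC.sqrt A, (CFC.sqrt_nonneg A).isSelfAdjoint, CFC.sqrt_mul_sqrt_self A hA⟩
  have hsym : ∀ x y : H, ⟪S x, y⟫_ℂ = ⟪x, S y⟫_ℂ := fun x y => by
    rw [← ContinuousLinearMap.adjoint_inner_right, ← ContinuousLinearMap.star_eq_adjoint,
      hS.star_eq]
  have key : ∀ x : H, (⟪A x, x⟫_ℂ).re = ‖S x‖ ^ 2 := fun x => by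
    rw [← hSA, mul_apply_eq_comp, hsym, inner_self_eq_norm_sq_to_K]
    norm_cast
  unfold posTrace
  simp_rw [key]
  set c := (exists_hilbertBasis ℂ H).choose_spec.choose
  calc ∑' j, ENNReal.ofReal (‖S (c j)‖ ^ 2)
      = ∑' j, ∑' i, ENNReal.ofReal (‖⟪b i, S (c j)⟫_ℂ‖ ^ 2) :=
        tsum_congr fun j => (tsum_norm_inner_sq b (S (c j))).symm
    _ = ∑' i, ∑' j, ENNReal.ofReal (‖⟪b i, S (c j)⟫_ℂ‖ ^ 2) := ENNReal.tsum_comm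
    _ = ∑' i, ∑' j, ENNReal.ofReal (‖⟪c j, S (b i)⟫_ℂ‖ ^ 2) :=
        tsum_congr fun i => tsum_congr fun j => by rw [← hsym, norm_inner_symm]
    _ = ∑' i, ENNReal.ofReal (‖S (b i)‖ ^ 2) :=
        tsum_congr fun i => tsum_norm_inner_sq c (S (b i))

/-- `tr (|T| ^ p) ∈ [0, ∞]`, where `|T| = (T* T) ^ (1 / 2)` and the power is taken in the continuous
functional calculus. -/
def schattenTrace (p : ℝ) (T : H →L[ℂ] H) : ℝ≥0∞ :=
  posTrace (CFC.abs T ^ p)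

/-- `T` belongs to the Schatten `p`-class: `T` is compact and `tr (|T| ^ p) < ∞`. -/
def MemSchatten (p : ℝ) (T : H →L[ℂ] H) : Prop :=
  IsCompactOperator T ∧ schattenTrace p T < ∞

/-- The Schatten `p`-norm `(tr (|T| ^ p)) ^ (1 / p)`, with value `∞` when the trace is infinite. -/
def schattenNorm (p : ℝ) (T : H →L[ℂ] H) : ℝ≥0∞ :=
  schattenTrace p T ^ (1 / p)

/-- The Schatten `p`-numerical radius `sup_θ ‖Re (e^{iθ} T)‖_p` of one operator. -/
def schattenNumRadius (p : ℝ) (T : H →L[ℂ] H) : ℝ≥0∞ :=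
  ⨆ θ : ℝ, schattenNorm p ((ℜ (Complex.exp (θ * Complex.I) • T) : H →L[ℂ] H))

variable {d : ℕ}

/-- The modulus `P = (T₁* T₁ + ⋯ + T_d* T_d) ^ (1 / 2)` of an operator tuple. -/
def tupleModulus (T : Fin d → (H →L[ℂ] H)) : H →L[ℂ] H :=
  CFC.sqrt (∑ i, star (T i) * T i)

/-- The tuple belongs to the spherical Schatten `p`-class: `tr (P ^ p) < ∞`. -/
def MemSphericalSchatten (p : ℝ) (T : Fin d → (H →L[ℂ] H)) : Prop :=
  posTrace (tupleModulus T ^ p) < ∞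

/-- The spherical Schatten `p`-norm `(tr (P ^ p)) ^ (1 / p)` of a tuple. -/
def sphericalSchattenNorm (p : ℝ) (T : Fin d → (H →L[ℂ] H)) : ℝ≥0∞ :=
  posTrace (tupleModulus T ^ p) ^ (1 / p)

/-- The combination `z₁ T₁ + ⋯ + z_d T_d`. -/
def combo (z : EuclideanSpace ℂ (Fin d)) (T : Fin d → (H →L[ℂ] H)) : H →L[ℂ] H :=
  ∑ i, z i • T i

/-- The joint Schatten `p`-numerical radius: the supremum of the Schatten `p`-numerical radii of
`z₁ T₁ + ⋯ + z_d T_d` over the closed Euclidean unit ball of `ℂ^d`. -/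
def jointSchattenNumRadius (p : ℝ) (T : Fin d → (H →L[ℂ] H)) : ℝ≥0∞ :=
  ⨆ z ∈ Metric.closedBall (0 : EuclideanSpace ℂ (Fin d)) 1, schattenNumRadius p (combo z T)

/-- The Schatten hypo-`p`-norm: the supremum of the Schatten `p`-norms of
`z₁ T₁ + ⋯ + z_d T_d` over the closed Euclidean unit ball of `ℂ^d`. -/
def schattenHypoNorm (p : ℝ) (T : Fin d → (H →L[ℂ] H)) : ℝ≥0∞ :=
  ⨆ z ∈ Metric.closedBall (0 : EuclideanSpace ℂ (Fin d)) 1, schattenNorm p (combo z T)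

end SchattenTuple

end

-- Write `Y = combo z T` with `‖z‖ ≤ 1`, and let `P` be the modulus of the tuple. Cauchy–Schwarz
-- gives `‖Y x‖ ≤ ‖P x‖`, that is `Y* Y ≤ P²`, and operator monotonicity of the square root gives
-- `|Y| ≤ P`. Finiteness of `tr (P ^ p)` makes `P` compact
-- (`isCompactOperator_of_posTrace_rpow_lt_top`), hence also `Y`.
--
-- Right inequality: `t ↦ t ^ p` need not be operator monotone, but its trace is monotone
-- (`posTrace_rpow_mono`). On an eigenbasis of `|Y|` the eigenvalues satisfy `⟪|Y| e, e⟫ ≤ ⟪P e,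
-- e⟫`, and Jensen's inequality `⟪P e, e⟫ ^ p ≤ ⟪P ^ p e, e⟫` can be summed over the basis.
--
-- Left inequality: rotation by `e^{iθ}` leaves `|Y|` unchanged, so it suffices that real parts do
-- not increase `tr (|Y| ^ p)` (`schattenTrace_realPart_le`). On an eigenbasis of `ℜ Y` the
-- eigenvalues are real parts of diagonal entries of `Y`. Those entries are dominated by averages of
-- the singular values with doubly substochastic weights, so Jensen and an exchange of sums finish
-- (`tsum_enorm_inner_rpow_le`).

universe u

namespace SchattenTuple

/-! ### Eigenbases, functional calculus on eigenvectors, and Jensen's inequality. -/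

section Spectral

variable {H : Type*} [NormedAddCommGroup H] [InnerProductSpace ℂ H] [CompleteSpace H]

omit [CompleteSpace H] in
lemma mem_orthogonal_of_inner_hilbertBasis_eq_zero {V : Submodule ℂ H} {κ : Type*} (c : HilbertBasis κ ℂ V) {x : H}
    (hx : ∀ k, ⟪(c k : H), x⟫_ℂ = 0) : x ∈ Vᗮ := by
  rw [Submodule.mem_orthogonal']
  intro u hu
  have hs := ((c.hasSum_repr ⟨u, hu⟩).mapL V.subtypeL).mapL (innerSL ℂ x)
  refine hs.unique ?_
  convert hasSum_zero with k
  simp [inner_eq_zero_symm.1 (hx k)]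

/-- Hilbert bases of the members of a total orthogonal family of complete subspaces combine to a
Hilbert basis of the whole space. -/
lemma exists_hilbertBasis_of_orthogonalFamily {H : Type u} [NormedAddCommGroup H]
    [InnerProductSpace ℂ H] [CompleteSpace H] {V : ℂ → Submodule ℂ H}
    (hV : OrthogonalFamily ℂ (fun μ => V μ) fun μ => (V μ).subtypeₗᵢ)
    (hcl : ∀ μ, CompleteSpace (V μ)) (h0 : (⨆ μ, V μ)ᗮ = ⊥) :
    ∃ (ι : Type u) (b : HilbertBasis ι ℂ H) (m : ι → ℂ), ∀ i, b i ∈ V (m i) := by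
  choose w c hwc using fun μ => exists_hilbertBasis ℂ (V μ)
  have hon : Orthonormal ℂ fun x : Σ μ, w μ => ((c x.1 x.2 : V x.1) : H) :=
    hV.orthonormal_sigma_orthonormal fun μ => (c μ).orthonormal
  have hbot : (Submodule.span ℂ (Set.range fun x : Σ μ, w μ => ((c x.1 x.2 : V x.1) : H)))ᗮ
      = ⊥ := by
    rw [eq_bot_iff, ← h0]
    intro x hx
    rw [Submodule.mem_orthogonal] at hx
    rw [← Submodule.iInf_orthogonal, Submodule.mem_iInf]
    exact fun μ => mem_orthogonal_of_inner_hilbertBasis_eq_zero (c μ) fun k =>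
      hx _ (Submodule.subset_span ⟨⟨μ, k⟩, rfl⟩)
  refine ⟨_, HilbertBasis.mkOfOrthogonalEqBot hon hbot, fun x => x.1, fun x => ?_⟩
  rw [HilbertBasis.coe_mkOfOrthogonalEqBot]
  exact (c x.1 x.2).2

/-- A compact self-adjoint operator has a Hilbert basis of eigenvectors with real eigenvalues. -/
lemma exists_hilbertBasis_eigenvectors {H : Type u} [NormedAddCommGroup H]
    [InnerProductSpace ℂ H] [CompleteSpace H] {A : H →L[ℂ] H} (hA : IsSelfAdjoint A)
    (hc : IsCompactOperator A) :
    ∃ (ι : Type u) (b : HilbertBasis ι ℂ H) (a : ι → ℝ), ∀ i, A (b i) = (a i : ℂ) • b i := by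
  have hsym : (A : H →ₗ[ℂ] H).IsSymmetric := hA.isSymmetric
  have hcl : ∀ μ, CompleteSpace (Module.End.eigenspace (A : H →ₗ[ℂ] H) μ) := fun μ => by
    have h1 : (Module.End.eigenspace (A : H →ₗ[ℂ] H) μ : Set H) = {x | A x = μ • x} := by
      ext x
      exact Module.End.mem_eigenspace_iff
    have h2 : IsClosed (Module.End.eigenspace (A : H →ₗ[ℂ] H) μ : Set H) := by
      rw [h1]
      exact isClosed_eq A.continuous (continuous_const_smul μ)
    exact h2.completeSpace_coe
  obtain ⟨ι, b, m, hb⟩ := exists_hilbertBasis_of_orthogonalFamily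
    hsym.orthogonalFamily_eigenspaces hcl
    (ContinuousLinearMap.orthogonalComplement_iSup_eigenspaces_eq_bot hc hsym)
  refine ⟨ι, b, fun i => (m i).re, fun i => ?_⟩
  have h2 : (starRingEnd ℂ) (m i) = m i :=
    hsym.conj_eigenvalue_eq_self
      (Module.End.hasEigenvalue_of_hasEigenvector ⟨hb i, b.orthonormal.ne_zero i⟩)
  rw [Complex.conj_eq_iff_re.1 h2]
  exact Module.End.mem_eigenspace_iff.1 (hb i)

/-- The functional calculus acts on an eigenvector by the value of the function. -/
lemma cfc_apply_eigenvector {A : H →L[ℂ] H} (hA : IsSelfAdjoint A) {f : ℝ → ℝ}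
    (hf : Continuous f) {a : ℝ} {e : H} (he : A e = (a : ℂ) • e) :
    cfc f A e = (f a : ℂ) • e := by
  rcases eq_or_ne e 0 with rfl | he0
  · simp
  -- If `a - A` had a left inverse, that inverse would send `0 = (a - A) e` to `e`.
  have hmem : a ∈ spectrum ℝ A := by
    rw [spectrum.mem_iff]
    intro hu
    apply he0
    have hinj : (algebraMap ℝ (H →L[ℂ] H) a - A) e = 0 := by
      simp [Algebra.algebraMap_eq_smul_one, he]
    obtain ⟨u, hu⟩ := hu
    have := congrArg (fun B : H →L[ℂ] H => B e) u.inv_mul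
    simpa [hu, hinj] using this.symm
  rw [cfc_apply f A hA hf.continuousOn]
  -- Stone–Weierstrass: the identity holds for polynomials and is a closed condition on `g`.
  have key : ∀ g : C(spectrum ℝ A, ℝ), cfcHom (R := ℝ) (a := A) hA g e
      = (g ⟨a, hmem⟩ : ℂ) • e := by
    intro g
    induction g using ContinuousMap.induction_on_of_compact with
    | const r =>
      have : ContinuousMap.const (spectrum ℝ A) r = algebraMap ℝ C(spectrum ℝ A, ℝ) r := rfl
      rw [this, AlgHomClass.commutes]
      simp [Algebra.algebraMap_eq_smul_one]
    | id =>
      have : cfcHom (R := ℝ) (a := A) hA (ContinuousMap.restrict _ (.id ℝ)) = A := cfcHom_id hA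
      rw [this, he]
      rfl
    | star_id =>
      have : cfcHom (R := ℝ) (a := A) hA (ContinuousMap.restrict _ (.id ℝ)) = A := cfcHom_id hA
      rw [map_star, this, hA.star_eq, he]
      rfl
    | add f g hf hg => simp [hf, hg, add_smul]
    | mul f g hf hg =>
      rw [map_mul, mul_apply_eq_comp, hg, map_smul, hf, smul_smul, ContinuousMap.mul_apply,
        Complex.ofReal_mul, mul_comm]
    | frequently f hf =>
      have hcl : IsClosed {g : C(spectrum ℝ A, ℝ) |
          cfcHom (R := ℝ) (a := A) hA g e = (g ⟨a, hmem⟩ : ℂ) • e} := by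
        refine isClosed_eq ?_ ?_
        · exact ((ContinuousLinearMap.apply ℂ H e).continuous.comp (cfcHom_continuous hA))
        · exact (Complex.continuous_ofReal.comp
            (ContinuousEvalConst.continuous_eval_const _)).smul continuous_const
      exact hcl.mem_of_frequently_of_tendsto hf Filter.tendsto_id
  rw [key]
  rfl

lemma rpow_apply_eigenvector {A : H →L[ℂ] H} (hA : 0 ≤ A) {p : ℝ} (hp : 0 ≤ p) {a : ℝ} {e : H}
    (he : A e = (a : ℂ) • e) : (A ^ p) e = ((a ^ p : ℝ) : ℂ) • e := by
  rw [CFC.rpow_eq_cfc_real hA]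
  exact cfc_apply_eigenvector hA.isSelfAdjoint (Real.continuous_rpow_const hp) he

lemma abs_apply_eigenvector {A : H →L[ℂ] H} (hA : IsSelfAdjoint A) {a : ℝ} {e : H}
    (he : A e = (a : ℂ) • e) : CFC.abs A e = ((|a| : ℝ) : ℂ) • e := by
  rw [CFC.abs_eq_cfc_norm A hA]
  exact cfc_apply_eigenvector hA continuous_norm he

omit [CompleteSpace H] in
lemma re_inner_nonneg {A : H →L[ℂ] H} (hA : 0 ≤ A) (x : H) : 0 ≤ (⟪A x, x⟫_ℂ).re :=
  ((ContinuousLinearMap.nonneg_iff_isPositive A).1 hA).re_inner_nonneg_left x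

omit [CompleteSpace H] in
lemma re_inner_mono {A B : H →L[ℂ] H} (h : A ≤ B) (x : H) :
    (⟪A x, x⟫_ℂ).re ≤ (⟪B x, x⟫_ℂ).re := by
  have := ((ContinuousLinearMap.le_def A B).1 h).re_inner_nonneg_left x
  simpa [inner_sub_left] using this

/-- The tangent line of a power lies below it. -/
lemma tangent_le_rpow {p : ℝ} (hp : 1 ≤ p) {s t : ℝ} (hs : 0 < s) (ht : 0 ≤ t) :
    (1 - p) * s ^ p + p * s ^ (p - 1) * t ≤ t ^ p := by
  have h := one_add_mul_self_le_rpow_one_add (s := t / s - 1)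
    (by have : 0 ≤ t / s := by positivity
        linarith) hp
  rw [add_sub_cancel, Real.div_rpow ht hs.le, le_div_iff₀ (by positivity)] at h
  have e : s ^ p = s ^ (p - 1) * s := by
    rw [← Real.rpow_add_one hs.ne', sub_add_cancel]
  calc _ = (1 + p * (t / s - 1)) * s ^ p := by
        rw [e]
        field_simp
        ring
    _ ≤ _ := h

omit [CompleteSpace H] in
lemma re_inner_real_smul (r : ℝ) (x y : H) : (⟪r • x, y⟫_ℂ).re = r * (⟪x, y⟫_ℂ).re := by
  rw [← Complex.coe_smul, inner_smul_left, Complex.conj_ofReal, Complex.re_ofReal_mul]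

omit [CompleteSpace H] in
lemma re_inner_affine (A : H →L[ℂ] H) (c d : ℝ) {e : H} (he : ‖e‖ = 1) :
    (⟪(algebraMap ℝ (H →L[ℂ] H) c + d • A) e, e⟫_ℂ).re = c + d * (⟪A e, e⟫_ℂ).re := by
  have hee : ⟪e, e⟫_ℂ = 1 := by rw [inner_self_eq_norm_sq_to_K, he]; simp
  have h : (algebraMap ℝ (H →L[ℂ] H) c + d • A) e = c • e + d • A e := by
    simp [Algebra.algebraMap_eq_smul_one]
  rw [h, inner_add_left, Complex.add_re, re_inner_real_smul, re_inner_real_smul, hee,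
    Complex.one_re, mul_one]

/-- Jensen's inequality for the state given by a unit vector. -/
lemma re_inner_rpow_le {A : H →L[ℂ] H} (hA : 0 ≤ A) {p : ℝ} (hp : 1 ≤ p) {e : H}
    (he : ‖e‖ = 1) : (⟪A e, e⟫_ℂ).re ^ p ≤ (⟪(A ^ p) e, e⟫_ℂ).re := by
  set s := (⟪A e, e⟫_ℂ).re with hs
  rcases (re_inner_nonneg hA e).eq_or_lt with h0 | h0
  · rw [← hs] at h0
    rw [← h0, Real.zero_rpow (by linarith)]
    exact re_inner_nonneg CFC.rpow_nonneg e
  rw [← hs] at h0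
  -- The tangent line of `t ^ p` at the mean `s`, applied to `A`; evaluated at `e`, its left side is
  -- exactly `s ^ p`.
  have hle : algebraMap ℝ (H →L[ℂ] H) ((1 - p) * s ^ p) + (p * s ^ (p - 1)) • A ≤ A ^ p := by
    have h1 : cfc (fun t : ℝ => (1 - p) * s ^ p + (p * s ^ (p - 1)) * t) A
        = algebraMap ℝ (H →L[ℂ] H) ((1 - p) * s ^ p) + (p * s ^ (p - 1)) • A := by
      rw [cfc_const_add _ _ A (by fun_prop) hA.isSelfAdjoint, cfc_const_mul_id _ A hA.isSelfAdjoint]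
    rw [← h1, CFC.rpow_eq_cfc_real hA]
    refine cfc_mono (fun t ht => tangent_le_rpow hp h0 (spectrum_nonneg_of_nonneg hA ht))
      (by fun_prop) (Real.continuous_rpow_const (by linarith)).continuousOn
  have h2 := re_inner_mono hle e
  rw [re_inner_affine A _ _ he, ← hs] at h2
  have e : s ^ p = s ^ (p - 1) * s := by
    rw [← Real.rpow_add_one h0.ne', sub_add_cancel]
  nlinarith

end Spectral

/-! ### Compactness from domination and from finite traces. -/

section Compactness

variable {H : Type*} [NormedAddCommGroup H] [InnerProductSpace ℂ H] [CompleteSpace H]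

/-- An operator that is small wherever a compact operator is small is compact. -/
lemma isCompactOperator_of_dominated {K L : H →L[ℂ] H} (hK : IsCompactOperator K)
    (h : ∀ ε > 0, ∃ δ > 0, ∀ x, ‖x‖ ≤ 2 → ‖K x‖ < δ → ‖L x‖ < ε) : IsCompactOperator L := by
  rw [show (L : H → H) = ((L : H →ₗ[ℂ] H) : H → H) from rfl,
    isCompactOperator_iff_isCompact_closure_image_closedBall (L : H →ₗ[ℂ] H) one_pos]
  have hK' : TotallyBounded (K '' Metric.closedBall 0 1) :=
    (IsCompactOperator.isCompact_closure_image_closedBall (f := (K : H →ₗ[ℂ] H))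
      hK 1).totallyBounded.subset subset_closure
  refine TotallyBounded.isCompact_of_isClosed (TotallyBounded.closure ?_) isClosed_closure
  rw [Metric.totallyBounded_iff]
  intro ε hε
  obtain ⟨δ, hδ, hd⟩ := h ε hε
  -- The net is chosen with centres `K z`, `z` in the unit ball, so that `L z` can serve as centres
  -- for `L`; the differences `x - z` account for the bound `2`.
  obtain ⟨t, ht, htf, hcov⟩ := (Set.exists_subset_image_finite_and (f := K)
    (p := fun t => K '' Metric.closedBall 0 1 ⊆ ⋃ y ∈ t, Metric.ball y δ)).1
    (Metric.finite_approx_of_totallyBounded hK' δ hδ)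
  refine ⟨L '' t, htf.image L, ?_⟩
  rintro _ ⟨x, hx, rfl⟩
  obtain ⟨_, ⟨z, hz, rfl⟩, hy⟩ := Set.mem_iUnion₂.1 (hcov ⟨x, hx, rfl⟩)
  refine Set.mem_biUnion ⟨z, hz, rfl⟩ ?_
  rw [Metric.mem_ball, dist_eq_norm] at hy ⊢
  change ‖L x - L z‖ < ε
  rw [← map_sub] at hy ⊢
  refine hd _ ?_ hy
  have h1 := mem_closedBall_zero_iff.1 hx
  have h2 := mem_closedBall_zero_iff.1 (ht hz)
  linarith [norm_sub_le x z]

lemma isCompactOperator_of_norm_le {K L : H →L[ℂ] H} (hK : IsCompactOperator K)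
    (h : ∀ x, ‖L x‖ ≤ ‖K x‖) : IsCompactOperator L :=
  isCompactOperator_of_dominated hK fun ε hε => ⟨ε, hε, fun x _ hx => (h x).trans_lt hx⟩

/-- The adjoint of a compact operator is compact. -/
lemma isCompactOperator_star {Y : H →L[ℂ] H} (hY : IsCompactOperator Y) :
    IsCompactOperator (star Y : H →L[ℂ] H) := by
  have hK : IsCompactOperator (Y * star Y) := hY.comp_clm (star Y)
  -- `‖Y* x‖² = ⟪Y Y* x, x⟫ ≤ ‖Y Y* x‖ ‖x‖` and `‖x‖ ≤ 2`, whence `ε ^ 2 / 2`.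
  refine isCompactOperator_of_dominated hK fun ε hε => ⟨ε ^ 2 / 2, by positivity, fun x hx hKx => ?_⟩
  have h1 : ‖(star Y) x‖ ^ 2 ≤ ‖(Y * star Y) x‖ * ‖x‖ := by
    have : (⟪(Y * star Y) x, x⟫_ℂ) = ⟪(star Y) x, (star Y) x⟫_ℂ := by
      rw [ContinuousLinearMap.star_eq_adjoint, ContinuousLinearMap.adjoint_inner_right]
      rfl
    have h2 := norm_inner_le_norm (𝕜 := ℂ) ((Y * star Y) x) x
    rw [this, inner_self_eq_norm_sq_to_K] at h2
    simpa using h2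
  refine lt_of_pow_lt_pow_left₀ 2 hε.le (h1.trans_lt ?_)
  nlinarith [norm_nonneg x, norm_nonneg ((Y * star Y) x)]

/-- A self-adjoint Hilbert–Schmidt operator is compact. -/
lemma isCompactOperator_of_tsum_norm_sq_ne_top {ι : Type*} (b : HilbertBasis ι ℂ H)
    {S : H →L[ℂ] H} (hS : IsSelfAdjoint S)
    (h : ∑' i, ENNReal.ofReal (‖S (b i)‖ ^ 2) ≠ ∞) : IsCompactOperator S := by
  classical
  -- Finite-rank truncations: `S` followed by the projection onto the span of `b i`, `i ∈ F`. They
  -- converge to `S` in operator norm.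
  let G : Finset ι → H →L[ℂ] H := fun F =>
    ∑ i ∈ F, ((innerSL ℂ (b i)).comp S).smulRight (b i)
  have hG : ∀ F, IsCompactOperator (G F) := fun F => by
    refine (compactOperator (RingHom.id ℂ) H H).sum_mem fun i _ => ?_
    have h1 : IsCompactOperator (ContinuousLinearMap.toSpanSingleton ℂ (b i)) :=
      isCompactOperator_of_locallyCompactSpace_rng (ContinuousLinearMap.toSpanSingleton ℂ (b i))
    exact h1.comp_clm ((innerSL ℂ (b i)).comp S)
  have hGx : ∀ F x, G F x = ∑ i ∈ F, ⟪b i, S x⟫_ℂ • b i := fun F x => by simp [G]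
  have hcoord : ∀ F x j, ENNReal.ofReal (‖⟪b j, S x - G F x⟫_ℂ‖ ^ 2) ≤
      (if j ∈ F then 0 else ENNReal.ofReal (‖S (b j)‖ ^ 2)) * ENNReal.ofReal (‖x‖ ^ 2) := by
    intro F x j
    have h1 : ⟪b j, S x - G F x⟫_ℂ = if j ∈ F then 0 else ⟪b j, S x⟫_ℂ := by
      rw [inner_sub_right, hGx, inner_sum]
      simp_rw [inner_smul_right, orthonormal_iff_ite.1 b.orthonormal j]
      split_ifs with hj <;> simp [hj]
    rw [h1]
    split_ifs with hj
    · simp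
    -- Self-adjointness turns `⟪b j, S x⟫` into `⟪S b j, x⟫`, so the tail of the Hilbert–Schmidt sum
    -- controls the error uniformly in `x`.
    · rw [← ENNReal.ofReal_mul (by positivity), ← mul_pow,
        ← ContinuousLinearMap.adjoint_inner_left, ← ContinuousLinearMap.star_eq_adjoint,
        hS.star_eq]
      exact ENNReal.ofReal_le_ofReal (by gcongr; exact norm_inner_le_norm _ _)
  refine isCompactOperator_of_tendsto (l := Filter.atTop) (F := G) ?_ (Filter.Eventually.of_forall hG)
  rw [Metric.tendsto_atTop]
  intro ε hε
  have hlim := (ENNReal.tendsto_tsum_compl_atTop_zero h).eventually_le_const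
    (u := ENNReal.ofReal ((ε / 2) ^ 2)) (by positivity)
  obtain ⟨F₀, hF₀⟩ := Filter.eventually_atTop.1 hlim
  refine ⟨F₀, fun F hF => ?_⟩
  rw [dist_comm, dist_eq_norm]
  refine lt_of_le_of_lt (ContinuousLinearMap.opNorm_le_bound _ (by positivity) fun x => ?_)
    (half_lt_self hε)
  have htail : ∑' j, (if j ∈ F then 0 else ENNReal.ofReal (‖S (b j)‖ ^ 2)) ≤
      ENNReal.ofReal ((ε / 2) ^ 2) := by
    refine le_trans (le_of_eq ?_) (hF₀ F hF)
    refine ((tsum_subtype {j | j ∉ F} fun j => ENNReal.ofReal (‖S (b j)‖ ^ 2)).trans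
      (tsum_congr fun j => ?_)).symm
    by_cases hj : j ∈ F <;> simp [Set.indicator, hj]
  have hsq : ENNReal.ofReal (‖S x - G F x‖ ^ 2) ≤ ENNReal.ofReal ((ε / 2 * ‖x‖) ^ 2) := by
    rw [← tsum_norm_inner_sq b, mul_pow, ENNReal.ofReal_mul (by positivity)]
    refine (ENNReal.tsum_le_tsum (hcoord F x)).trans ?_
    rw [ENNReal.tsum_mul_right]
    gcongr
  exact le_of_sq_le_sq ((ENNReal.ofReal_le_ofReal_iff (by positivity)).1 hsq) (by positivity)

lemma norm_sqrt_apply_sq {A : H →L[ℂ] H} (hA : 0 ≤ A) (x : H) :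
    ‖CFC.sqrt A x‖ ^ 2 = (⟪A x, x⟫_ℂ).re := by
  have hsym : ((CFC.sqrt A : H →L[ℂ] H) : H →ₗ[ℂ] H).IsSymmetric := (CFC.sqrt_nonneg A).isSelfAdjoint.isSymmetric
  have h1 : A x = CFC.sqrt A (CFC.sqrt A x) := by
    conv_lhs => rw [← CFC.sqrt_mul_sqrt_self A hA]
    rfl
  rw [h1, show ⟪CFC.sqrt A (CFC.sqrt A x), x⟫_ℂ = ⟪CFC.sqrt A x, CFC.sqrt A x⟫_ℂ from hsym _ _,
    inner_self_eq_norm_sq_to_K]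
  norm_cast

/-- Jensen's inequality for the unit vector `x / ‖x‖`, rescaled. It lets compactness pass from `√(A
^ p)` to `√A`. -/
lemma norm_sqrt_apply_rpow_le {A : H →L[ℂ] H} (hA : 0 ≤ A) {p : ℝ} (hp : 1 ≤ p) (x : H) :
    ‖CFC.sqrt A x‖ ^ p ≤ ‖x‖ ^ (p - 1) * ‖CFC.sqrt (A ^ p) x‖ := by
  rcases eq_or_ne x 0 with rfl | hx
  · simp [Real.zero_rpow (show p ≠ 0 by linarith)]
  have hx0 : 0 < ‖x‖ := norm_pos_iff.2 hx
  obtain ⟨e, he, hxe⟩ : ∃ e : H, ‖e‖ = 1 ∧ x = (‖x‖ : ℂ) • e :=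
    ⟨(‖x‖ : ℂ)⁻¹ • x, norm_smul_inv_norm hx, (smul_inv_smul₀ (by exact_mod_cast hx0.ne') x).symm⟩
  have hunit : ‖CFC.sqrt A e‖ ^ p ≤ ‖CFC.sqrt (A ^ p) e‖ := by
    have h1 := re_inner_rpow_le hA hp he
    rw [← norm_sqrt_apply_sq hA e,
      ← norm_sqrt_apply_sq (CFC.rpow_nonneg : (0 : H →L[ℂ] H) ≤ A ^ p) e] at h1
    have h2 : ∀ t : ℝ, 0 ≤ t → (t ^ 2) ^ p = (t ^ p) ^ 2 := fun t ht => by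
      rw [← Real.rpow_natCast, ← Real.rpow_natCast, ← Real.rpow_mul ht, ← Real.rpow_mul ht,
        mul_comm]
    rw [h2 _ (norm_nonneg _)] at h1
    exact le_of_sq_le_sq h1 (norm_nonneg _)
  have hn : ∀ B : H →L[ℂ] H, ‖B x‖ = ‖x‖ * ‖B e‖ := fun B => by
    conv_lhs => rw [hxe]
    rw [map_smul, norm_smul, Complex.norm_real, norm_norm]
  rw [hn, hn, Real.mul_rpow (norm_nonneg _) (norm_nonneg _), ← mul_assoc,
    ← Real.rpow_add_one hx0.ne', sub_add_cancel]
  gcongr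

/-- A positive operator is compact if one of its powers has finite trace. -/
lemma isCompactOperator_of_posTrace_rpow_lt_top {A : H →L[ℂ] H} (hA : 0 ≤ A) {p : ℝ} (hp : 1 ≤ p)
    (h : posTrace (A ^ p) < ∞) : IsCompactOperator A := by
  obtain ⟨w, b, -⟩ := exists_hilbertBasis ℂ H
  -- The squared Hilbert–Schmidt norm of `√(A ^ p)` is `tr (A ^ p)`.
  have hS : IsCompactOperator (CFC.sqrt (A ^ p) : H →L[ℂ] H) := by
    refine isCompactOperator_of_tsum_norm_sq_ne_top b (CFC.sqrt_nonneg _).isSelfAdjoint ?_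
    simp_rw [norm_sqrt_apply_sq (CFC.rpow_nonneg (a := A) (y := p))]
    rw [← posTrace_eq_tsum b CFC.rpow_nonneg]
    exact h.ne
  have hR : IsCompactOperator (CFC.sqrt A : H →L[ℂ] H) := by
    refine isCompactOperator_of_dominated hS fun ε hε =>
      ⟨ε ^ p / 2 ^ (p - 1), by positivity, fun x hx hSx => ?_⟩
    refine (Real.rpow_lt_rpow_iff (norm_nonneg _) hε.le (show 0 < p by linarith)).1 ?_
    calc ‖CFC.sqrt A x‖ ^ p ≤ ‖x‖ ^ (p - 1) * ‖CFC.sqrt (A ^ p) x‖ :=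
          norm_sqrt_apply_rpow_le hA hp x
      _ ≤ 2 ^ (p - 1) * ‖CFC.sqrt (A ^ p) x‖ := by
          gcongr
      _ < 2 ^ (p - 1) * (ε ^ p / 2 ^ (p - 1)) := by gcongr
      _ = ε ^ p := by field_simp
  rw [← CFC.sqrt_mul_sqrt_self A hA]
  exact hR.comp_clm (CFC.sqrt A)

lemma norm_abs_apply (Y : H →L[ℂ] H) (x : H) : ‖CFC.abs Y x‖ = ‖Y x‖ := by
  have h1 : ‖CFC.abs Y x‖ ^ 2 = ‖Y x‖ ^ 2 := by
    rw [CFC.abs, norm_sqrt_apply_sq (star_mul_self_nonneg Y), ContinuousLinearMap.star_eq_adjoint,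
      mul_apply_eq_comp, ContinuousLinearMap.adjoint_inner_left, inner_self_eq_norm_sq_to_K]
    norm_cast
  exact (sq_eq_sq₀ (norm_nonneg _) (norm_nonneg _)).1 h1

lemma isCompactOperator_abs {Y : H →L[ℂ] H} (hY : IsCompactOperator Y) :
    IsCompactOperator (CFC.abs Y : H →L[ℂ] H) :=
  isCompactOperator_of_norm_le hY fun x => (norm_abs_apply Y x).le

end Compactness

/-! ### Trace inequalities: monotonicity, diagonal entries, real parts. -/

section Trace

variable {H : Type*} [NormedAddCommGroup H] [InnerProductSpace ℂ H] [CompleteSpace H]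

lemma posTrace_eq_tsum_eigenvalues {ι : Type*} (b : HilbertBasis ι ℂ H) {A : H →L[ℂ] H}
    (hA : 0 ≤ A) {a : ι → ℝ} (h : ∀ i, A (b i) = (a i : ℂ) • b i) :
    posTrace A = ∑' i, ENNReal.ofReal (a i) := by
  rw [posTrace_eq_tsum b hA]
  refine tsum_congr fun i => ?_
  rw [h i, inner_smul_left, inner_self_eq_norm_sq_to_K, b.orthonormal.norm_eq_one i]
  simp

omit [CompleteSpace H] in
lemma re_inner_eigenvector {A : H →L[ℂ] H} {a : ℝ} {e : H} (he : ‖e‖ = 1)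
    (h : A e = (a : ℂ) • e) : (⟪A e, e⟫_ℂ).re = a := by
  rw [h, inner_smul_left, inner_self_eq_norm_sq_to_K, he]
  simp

/-- The trace of the `p`-th power is monotone on positive operators. -/
lemma posTrace_rpow_mono {A B : H →L[ℂ] H} (hA : 0 ≤ A) (hAB : A ≤ B)
    (hc : IsCompactOperator A) {p : ℝ} (hp : 1 ≤ p) : posTrace (A ^ p) ≤ posTrace (B ^ p) := by
  have hB : 0 ≤ B := hA.trans hAB
  obtain ⟨ι, b, a, h⟩ := exists_hilbertBasis_eigenvectors hA.isSelfAdjoint hc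
  rw [posTrace_eq_tsum_eigenvalues b CFC.rpow_nonneg
      fun i => rpow_apply_eigenvector hA (by linarith) (h i),
    posTrace_eq_tsum b CFC.rpow_nonneg]
  refine ENNReal.tsum_le_tsum fun i => ENNReal.ofReal_le_ofReal ?_
  have hn := b.orthonormal.norm_eq_one i
  rw [← re_inner_eigenvector hn (h i)]
  refine le_trans ?_ (re_inner_rpow_le hB hp hn)
  exact Real.rpow_le_rpow (re_inner_nonneg hA _) (re_inner_mono hAB _) (by linarith)

/-- Both sides equal `⟪Y* Y x, y⟫`. Consequently `Y` maps an orthonormal eigenbasis of `|Y|` to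
orthogonal vectors. -/
lemma inner_abs_apply_abs_apply (Y : H →L[ℂ] H) (x y : H) :
    ⟪CFC.abs Y x, CFC.abs Y y⟫_ℂ = ⟪Y x, Y y⟫_ℂ := by
  have hsym : ((CFC.abs Y : H →L[ℂ] H) : H →ₗ[ℂ] H).IsSymmetric :=
    (CFC.abs_nonneg Y).isSelfAdjoint.isSymmetric
  have h1 : CFC.abs Y (CFC.abs Y x) = ContinuousLinearMap.adjoint Y (Y x) := by
    rw [← mul_apply_eq_comp, CFC.abs_mul_abs]
    rfl
  rw [← show ⟪CFC.abs Y (CFC.abs Y x), y⟫_ℂ = ⟪CFC.abs Y x, CFC.abs Y y⟫_ℂ from hsym _ _, h1,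
    ContinuousLinearMap.adjoint_inner_left]

omit [CompleteSpace H] in
/-- Bessel's inequality with values in `[0, ∞]`, for a family that is orthonormal up to zeros. -/
lemma tsum_norm_inner_sq_le {ι : Type*} {f : ι → H} {s : Set ι}
    (hf : Orthonormal ℂ fun i : s => f i) (h0 : ∀ i ∉ s, f i = 0) (x : H) :
    ∑' i, ENNReal.ofReal (‖⟪f i, x⟫_ℂ‖ ^ 2) ≤ ENNReal.ofReal (‖x‖ ^ 2) := by
  have h1 : ∑' i, ENNReal.ofReal (‖⟪f i, x⟫_ℂ‖ ^ 2)
      = ∑' i : s, ENNReal.ofReal (‖⟪f i, x⟫_ℂ‖ ^ 2) := by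
    refine (tsum_subtype_eq_of_support_subset fun i hi => ?_).symm
    by_contra his
    exact hi (by simp [h0 i his])
  have h2 : Summable fun i : s => ‖⟪f i, x⟫_ℂ‖ ^ 2 := Orthonormal.inner_products_summable x hf
  rw [h1, ← ENNReal.ofReal_tsum_of_nonneg (fun i => by positivity) h2]
  exact ENNReal.ofReal_le_ofReal (Orthonormal.tsum_inner_products_le x hf)

/-- The left singular vectors of an operator, given a basis of right singular vectors. -/
lemma exists_left_singular_vectors {Y : H →L[ℂ] H} {ι : Type*} (b : HilbertBasis ι ℂ H)
    {s : ι → ℝ} (h : ∀ i, CFC.abs Y (b i) = (s i : ℂ) • b i) :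
    ∃ f : ι → H, (∀ i, Y (b i) = (s i : ℂ) • f i) ∧ (∀ i, ‖f i‖ ≤ 1) ∧
      ∀ x, ∑' i, ENNReal.ofReal (‖⟪f i, x⟫_ℂ‖ ^ 2) ≤ ENNReal.ofReal (‖x‖ ^ 2) := by
  classical
  have hY : ∀ i, ‖Y (b i)‖ = |s i| := fun i => by
    rw [← norm_abs_apply, h, norm_smul, b.orthonormal.norm_eq_one i]
    simp
  have horth : Orthonormal ℂ fun i : {i | s i ≠ 0} => (s i : ℂ)⁻¹ • Y (b i) := by
    rw [orthonormal_iff_ite]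
    intro i j
    have hi : (s i : ℂ) ≠ 0 := by exact_mod_cast i.2
    have hj : (s j : ℂ) ≠ 0 := by exact_mod_cast j.2
    rw [inner_smul_left, inner_smul_right, ← inner_abs_apply_abs_apply, h, h, inner_smul_left,
      inner_smul_right, orthonormal_iff_ite.1 b.orthonormal]
    simp only [map_inv₀, Complex.conj_ofReal, Subtype.ext_iff]
    split_ifs with hij
    · field_simp
    · simp
  -- Since `0⁻¹ = 0`, this vector vanishes when `s i = 0`, as Bessel's inequality up to zeros
  -- requires.
  refine ⟨fun i => (s i : ℂ)⁻¹ • Y (b i), fun i => ?_, fun i => ?_, fun x => ?_⟩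
  · by_cases hi : s i = 0
    · have : Y (b i) = 0 := by rw [← norm_eq_zero, hY, hi, abs_zero]
      simp [hi, this]
    · rw [smul_inv_smul₀ (by exact_mod_cast hi)]
  · rw [norm_smul, hY, norm_inv, Complex.norm_real, Real.norm_eq_abs]
    exact inv_mul_le_one
  · refine tsum_norm_inner_sq_le horth (fun i hi => ?_) x
    simp [not_not.1 hi]

/-- Jensen's inequality for subprobability weights. -/
lemma tsum_mul_rpow_le {ι : Type*} {p : ℝ} (hp : 1 ≤ p) (w s : ι → ℝ≥0∞) (hw : ∑' i, w i ≤ 1) :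
    (∑' i, w i * s i) ^ p ≤ ∑' i, w i * s i ^ p := by
  have hp0 : 0 < p := by linarith
  rw [← ENNReal.le_rpow_inv_iff hp0]
  rw [ENNReal.tsum_eq_iSup_sum]
  refine iSup_le fun F => ?_
  refine (ENNReal.inner_le_weight_mul_Lp_of_nonneg F hp w s).trans ?_
  -- The factor left over by the weighted power-mean inequality; total mass at most `1` suffices.
  have h1 : (∑ i ∈ F, w i) ^ (1 - p⁻¹) ≤ 1 :=
    ENNReal.rpow_le_one ((ENNReal.sum_le_tsum F).trans hw)
      (by linarith [inv_le_one_of_one_le₀ hp])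
  calc _ ≤ 1 * (∑ i ∈ F, w i * s i ^ p) ^ p⁻¹ := by gcongr
    _ ≤ _ := by
      rw [one_mul]
      gcongr
      exact ENNReal.sum_le_tsum F

lemma enorm_mul_enorm_le (x y : ℂ) : ‖x‖ₑ * ‖y‖ₑ ≤
    2⁻¹ * (ENNReal.ofReal (‖x‖ ^ 2) + ENNReal.ofReal (‖y‖ ^ 2)) := by
  rw [← ofReal_norm, ← ofReal_norm, ← ENNReal.ofReal_mul (norm_nonneg x),
    ← ENNReal.ofReal_add (by positivity) (by positivity),
    show (2⁻¹ : ℝ≥0∞) = ENNReal.ofReal 2⁻¹ by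
      rw [ENNReal.ofReal_inv_of_pos two_pos, ENNReal.ofReal_ofNat],
    ← ENNReal.ofReal_mul (by norm_num)]
  exact ENNReal.ofReal_le_ofReal (by nlinarith [sq_nonneg (‖x‖ - ‖y‖)])

omit [CompleteSpace H] in
/-- The diagonal of an operator is dominated by an average of its singular values. -/
lemma enorm_inner_apply_self_le {Y : H →L[ℂ] H} {ι : Type*} (b : HilbertBasis ι ℂ H)
    {s : ι → ℝ} (hs : ∀ i, 0 ≤ s i) {f : ι → H} (hf : ∀ i, Y (b i) = (s i : ℂ) • f i) (e : H) :
    ‖⟪e, Y e⟫_ℂ‖ₑ ≤ ∑' i, 2⁻¹ * (ENNReal.ofReal (‖⟪b i, e⟫_ℂ‖ ^ 2) +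
      ENNReal.ofReal (‖⟪f i, e⟫_ℂ‖ ^ 2)) * ENNReal.ofReal (s i) := by
  -- Expanding `e` in `b` gives `⟪e, Y e⟫ = ∑ s i ⟪b i, e⟫ ⟪e, f i⟫`; each product of inner products
  -- is then split by the AM–GM inequality.
  have h1 := (((b.hasSum_repr e).mapL Y).mapL (innerSL ℂ e)).tsum_eq
  simp only [innerSL_apply_apply] at h1
  rw [← h1]
  refine enorm_tsum_le_tsum_enorm.trans (ENNReal.tsum_le_tsum fun i => ?_)
  rw [map_smul, hf, inner_smul_right, inner_smul_right, b.repr_apply_apply, enorm_mul, enorm_mul,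
    ← mul_assoc, mul_right_comm]
  have h2 : ‖(s i : ℂ)‖ₑ = ENNReal.ofReal (s i) := by
    rw [← ofReal_norm, Complex.norm_real, Real.norm_of_nonneg (hs i)]
  rw [h2]
  refine mul_le_mul_left ?_ _
  have h3 : ‖⟪e, f i⟫_ℂ‖ₑ = ‖⟪f i, e⟫_ℂ‖ₑ := by
    rw [← ofReal_norm, norm_inner_symm, ofReal_norm]
  rw [h3]
  exact enorm_mul_enorm_le _ _

lemma half_mul_add_le_one {x y : ℝ≥0∞} (hx : x ≤ 1) (hy : y ≤ 1) : 2⁻¹ * (x + y) ≤ 1 := by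
  calc 2⁻¹ * (x + y) ≤ 2⁻¹ * (1 + 1) := by gcongr
    _ = 1 := by rw [one_add_one_eq_two, ENNReal.inv_mul_cancel two_ne_zero ENNReal.ofNat_ne_top]

/-- The `p`-th powers of the diagonal entries of a compact operator, in any Hilbert basis, sum to
at most `tr (|Y| ^ p)`. -/
lemma tsum_enorm_inner_rpow_le {Y : H →L[ℂ] H} (hY : IsCompactOperator Y) {p : ℝ} (hp : 1 ≤ p)
    {κ : Type*} (c : HilbertBasis κ ℂ H) :
    ∑' j, ‖⟪c j, Y (c j)⟫_ℂ‖ₑ ^ p ≤ schattenTrace p Y := by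
  have hp0 : 0 ≤ p := by linarith
  have hnn := CFC.abs_nonneg Y
  obtain ⟨ι, b, s, h⟩ :=
    exists_hilbertBasis_eigenvectors hnn.isSelfAdjoint (isCompactOperator_abs hY)
  have hs : ∀ i, 0 ≤ s i := fun i => by
    rw [← re_inner_eigenvector (b.orthonormal.norm_eq_one i) (h i)]
    exact re_inner_nonneg hnn _
  obtain ⟨f, hf, hf1, hfx⟩ := exists_left_singular_vectors b h
  -- Doubly substochastic: row sums use Parseval for `b` and Bessel for `f`, column sums use
  -- Parseval for `c` and `‖f i‖ ≤ 1`. Rows feed Jensen, columns the final bound.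
  let w : κ → ι → ℝ≥0∞ := fun j i => 2⁻¹ * (ENNReal.ofReal (‖⟪b i, c j⟫_ℂ‖ ^ 2) +
      ENNReal.ofReal (‖⟪f i, c j⟫_ℂ‖ ^ 2))
  have hrow : ∀ j, ∑' i, w j i ≤ 1 := fun j => by
    rw [ENNReal.tsum_mul_left, ENNReal.tsum_add]
    refine half_mul_add_le_one ?_ ((hfx _).trans ?_)
    · rw [tsum_norm_inner_sq, c.orthonormal.norm_eq_one]; simp
    · rw [c.orthonormal.norm_eq_one]; simp
  have hcol : ∀ i, ∑' j, w j i ≤ 1 := fun i => by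
    rw [ENNReal.tsum_mul_left, ENNReal.tsum_add]
    have hsymm : ∀ x : H, ∑' j, ENNReal.ofReal (‖⟪x, c j⟫_ℂ‖ ^ 2) = ENNReal.ofReal (‖x‖ ^ 2) :=
      fun x => by
        rw [← tsum_norm_inner_sq c x]
        exact tsum_congr fun j => by rw [norm_inner_symm]
    rw [hsymm, hsymm]
    refine half_mul_add_le_one ?_ ?_
    · rw [b.orthonormal.norm_eq_one]; simp
    · rw [← ENNReal.ofReal_one]
      exact ENNReal.ofReal_le_ofReal (pow_le_one₀ (norm_nonneg _) (hf1 i))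
  calc ∑' j, ‖⟪c j, Y (c j)⟫_ℂ‖ₑ ^ p
      ≤ ∑' j, (∑' i, w j i * ENNReal.ofReal (s i)) ^ p := by
        gcongr with j
        exact enorm_inner_apply_self_le b hs hf (c j)
    _ ≤ ∑' j, ∑' i, w j i * ENNReal.ofReal (s i) ^ p :=
        ENNReal.tsum_le_tsum fun j => tsum_mul_rpow_le hp _ _ (hrow j)
    _ = ∑' i, (∑' j, w j i) * ENNReal.ofReal (s i) ^ p := by
        rw [ENNReal.tsum_comm]
        simp_rw [ENNReal.tsum_mul_right]
    _ ≤ ∑' i, ENNReal.ofReal (s i) ^ p :=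
        ENNReal.tsum_le_tsum fun i => mul_le_of_le_one_left zero_le (hcol i)
    _ = schattenTrace p Y := by
        rw [schattenTrace, posTrace_eq_tsum_eigenvalues b CFC.rpow_nonneg
          fun i => rpow_apply_eigenvector hnn hp0 (h i)]
        exact tsum_congr fun i => ENNReal.ofReal_rpow_of_nonneg (hs i) hp0

lemma isCompactOperator_realPart {Y : H →L[ℂ] H} (hY : IsCompactOperator Y) :
    IsCompactOperator ((ℜ Y : H →L[ℂ] H)) := by
  rw [realPart_apply_coe]
  exact (hY.add (isCompactOperator_star hY)).smul (2⁻¹ : ℝ)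

lemma enorm_ofReal_re_le (z : ℂ) : ENNReal.ofReal |z.re| ≤ ‖z‖ₑ := by
  rw [← ofReal_norm]
  exact ENNReal.ofReal_le_ofReal (Complex.abs_re_le_norm z)

lemma re_inner_realPart_apply_self (Y : H →L[ℂ] H) (e : H) :
    (⟪(ℜ Y : H →L[ℂ] H) e, e⟫_ℂ).re = (⟪e, Y e⟫_ℂ).re := by
  have h1 : (ℜ Y : H →L[ℂ] H) e = (2 : ℝ)⁻¹ • (Y e + ContinuousLinearMap.adjoint Y e) := by
    rw [realPart_apply_coe]
    rfl
  rw [h1, re_inner_real_smul, inner_add_left, ContinuousLinearMap.adjoint_inner_left,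
    ← inner_conj_symm (Y e) e, Complex.add_re, Complex.conj_re]
  ring

lemma schattenTrace_eq_tsum_eigenvalues {κ : Type*} (c : HilbertBasis κ ℂ H) {R : H →L[ℂ] H}
    (hR : IsSelfAdjoint R) {r : κ → ℝ} (h : ∀ j, R (c j) = (r j : ℂ) • c j) {p : ℝ} (hp : 0 ≤ p) :
    schattenTrace p R = ∑' j, ENNReal.ofReal |r j| ^ p := by
  have hnn : 0 ≤ CFC.abs R := CFC.abs_nonneg R
  have h1 : ∀ j, (CFC.abs R ^ p) (c j) = ((|r j| ^ p : ℝ) : ℂ) • c j := fun j =>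
    rpow_apply_eigenvector hnn hp (abs_apply_eigenvector hR (h j))
  rw [schattenTrace, posTrace_eq_tsum_eigenvalues c CFC.rpow_nonneg h1]
  exact tsum_congr fun j => (ENNReal.ofReal_rpow_of_nonneg (abs_nonneg _) hp).symm

/-- Taking the real part does not increase `tr (|Y| ^ p)`. -/
lemma schattenTrace_realPart_le {Y : H →L[ℂ] H} (hY : IsCompactOperator Y) {p : ℝ} (hp : 1 ≤ p) :
    schattenTrace p (ℜ Y : H →L[ℂ] H) ≤ schattenTrace p Y := by
  have hp0 : 0 ≤ p := by linarith
  have hsa : IsSelfAdjoint (ℜ Y : H →L[ℂ] H) := (ℜ Y).2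
  obtain ⟨κ, c, r, h⟩ := exists_hilbertBasis_eigenvectors hsa (isCompactOperator_realPart hY)
  rw [schattenTrace_eq_tsum_eigenvalues c hsa h hp0]
  refine le_trans (ENNReal.tsum_le_tsum fun j => ENNReal.rpow_le_rpow ?_ hp0)
    (tsum_enorm_inner_rpow_le hY hp c)
  rw [← re_inner_eigenvector (c.orthonormal.norm_eq_one j) (h j), re_inner_realPart_apply_self]
  exact enorm_ofReal_re_le _

end Trace

/-! ### Domination of combinations by the modulus of the tuple. -/

section Tuple

variable {H : Type*} [NormedAddCommGroup H] [InnerProductSpace ℂ H] [CompleteSpace H] {d : ℕ}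

lemma sum_star_mul_self_nonneg (T : Fin d → (H →L[ℂ] H)) : 0 ≤ ∑ i, star (T i) * T i :=
  Finset.sum_nonneg fun i _ => star_mul_self_nonneg (T i)

lemma tupleModulus_nonneg (T : Fin d → (H →L[ℂ] H)) : 0 ≤ tupleModulus T :=
  CFC.sqrt_nonneg _

lemma inner_star_mul_self_apply (Y : H →L[ℂ] H) (x : H) :
    (⟪(star Y * Y) x, x⟫_ℂ).re = ‖Y x‖ ^ 2 := by
  rw [ContinuousLinearMap.star_eq_adjoint, mul_apply_eq_comp,
    ContinuousLinearMap.adjoint_inner_left, inner_self_eq_norm_sq_to_K]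
  norm_cast

lemma re_inner_sum_star_mul_self (T : Fin d → (H →L[ℂ] H)) (x : H) :
    (⟪(∑ i, star (T i) * T i) x, x⟫_ℂ).re = ∑ i, ‖T i x‖ ^ 2 := by
  rw [sum_apply, sum_inner, Complex.re_sum]
  exact Finset.sum_congr rfl fun i _ => inner_star_mul_self_apply (T i) x

lemma norm_tupleModulus_apply_sq (T : Fin d → (H →L[ℂ] H)) (x : H) :
    ‖tupleModulus T x‖ ^ 2 = ∑ i, ‖T i x‖ ^ 2 := by
  rw [tupleModulus, norm_sqrt_apply_sq (sum_star_mul_self_nonneg T), re_inner_sum_star_mul_self]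

omit [CompleteSpace H] in
/-- The Cauchy–Schwarz inequality for a combination with coefficients in the unit ball. -/
lemma norm_combo_apply_sq_le {z : EuclideanSpace ℂ (Fin d)} (hz : ‖z‖ ≤ 1)
    (T : Fin d → (H →L[ℂ] H)) (x : H) : ‖combo z T x‖ ^ 2 ≤ ∑ i, ‖T i x‖ ^ 2 := by
  have h1 : ‖combo z T x‖ ≤ ∑ i, ‖z i‖ * ‖T i x‖ := by
    have : combo z T x = ∑ i, z i • T i x := by simp [combo]
    rw [this]
    exact (norm_sum_le _ _).trans (Finset.sum_le_sum fun i _ => (norm_smul_le _ _))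
  calc ‖combo z T x‖ ^ 2 ≤ (∑ i, ‖z i‖ * ‖T i x‖) ^ 2 := by gcongr
    _ ≤ (∑ i, ‖z i‖ ^ 2) * ∑ i, ‖T i x‖ ^ 2 := Finset.sum_mul_sq_le_sq_mul_sq _ _ _
    _ ≤ 1 * ∑ i, ‖T i x‖ ^ 2 := by
        rw [← EuclideanSpace.norm_sq_eq]
        gcongr
        exact pow_le_one₀ (norm_nonneg _) hz
    _ = _ := one_mul _

lemma norm_combo_apply_le {z : EuclideanSpace ℂ (Fin d)} (hz : ‖z‖ ≤ 1)
    (T : Fin d → (H →L[ℂ] H)) (x : H) : ‖combo z T x‖ ≤ ‖tupleModulus T x‖ := by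
  refine le_of_sq_le_sq ?_ (norm_nonneg _)
  rw [norm_tupleModulus_apply_sq]
  exact norm_combo_apply_sq_le hz T x

/-- Cauchy–Schwarz compares the quadratic forms of the squares; the square root is operator
monotone. -/
lemma abs_combo_le_tupleModulus {z : EuclideanSpace ℂ (Fin d)} (hz : ‖z‖ ≤ 1)
    (T : Fin d → (H →L[ℂ] H)) : CFC.abs (combo z T) ≤ tupleModulus T := by
  refine CFC.sqrt_le_sqrt _ _ ?_
  rw [ContinuousLinearMap.le_def]
  refine (ContinuousLinearMap.isPositive_def' ).2 ⟨?_, fun x => ?_⟩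
  · exact (IsSelfAdjoint.of_nonneg (sum_star_mul_self_nonneg T)).sub (.star_mul_self _)
  · rw [ContinuousLinearMap.reApplyInnerSelf_apply, sub_apply, inner_sub_left, map_sub]
    have h1 := re_inner_sum_star_mul_self T x
    have h2 := inner_star_mul_self_apply (combo z T) x
    have h3 := norm_combo_apply_sq_le hz T x
    rw [← h1, ← h2] at h3
    exact sub_nonneg.2 h3

lemma schattenTrace_exp_smul (p θ : ℝ) (X : H →L[ℂ] H) :
    schattenTrace p (Complex.exp (θ * Complex.I) • X) = schattenTrace p X := by
  rw [schattenTrace, CFC.abs_smul, Complex.norm_exp_ofReal_mul_I, one_smul, schattenTrace]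

lemma isCompactOperator_combo {p : ℝ} (hp : 1 ≤ p) {T : Fin d → (H →L[ℂ] H)}
    (hT : MemSphericalSchatten p T) {z : EuclideanSpace ℂ (Fin d)} (hz : ‖z‖ ≤ 1) :
    IsCompactOperator (combo z T) := by
  have hP : IsCompactOperator (tupleModulus T) :=
    isCompactOperator_of_posTrace_rpow_lt_top (tupleModulus_nonneg T) hp hT
  exact isCompactOperator_of_norm_le hP (norm_combo_apply_le hz T)

lemma schattenTrace_combo_le {p : ℝ} (hp : 1 ≤ p) {T : Fin d → (H →L[ℂ] H)}
    {z : EuclideanSpace ℂ (Fin d)} (hz : ‖z‖ ≤ 1) (hc : IsCompactOperator (combo z T)) :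
    schattenTrace p (combo z T) ≤ posTrace (tupleModulus T ^ p) :=
  posTrace_rpow_mono (CFC.abs_nonneg (combo z T)) (abs_combo_le_tupleModulus hz T)
    (isCompactOperator_abs hc) hp

lemma isCompactOperator_and_schattenTrace_realPart_exp_smul_le {p : ℝ} (hp : 1 ≤ p) {X : H →L[ℂ] H}
    (hX : IsCompactOperator X) (θ : ℝ) :
    IsCompactOperator (ℜ (Complex.exp (θ * Complex.I) • X) : H →L[ℂ] H) ∧
      schattenTrace p (ℜ (Complex.exp (θ * Complex.I) • X) : H →L[ℂ] H) ≤ schattenTrace p X := by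
  have hc : IsCompactOperator (Complex.exp (θ * Complex.I) • X) := hX.smul _
  exact ⟨isCompactOperator_realPart hc,
    (schattenTrace_realPart_le hc hp).trans_eq (schattenTrace_exp_smul p θ X)⟩

end Tuple

end SchattenTuple


theorem theorem4p3 {H : Type*} [NormedAddCommGroup H] [InnerProductSpace ℂ H] [CompleteSpace H]
    [TopologicalSpace.SeparableSpace H] {d : ℕ} (p : ℝ) (hp : 1 ≤ p)
    (T : Fin d → (H →L[ℂ] H)) (hT : SchattenTuple.MemSphericalSchatten p T) :
    (∀ z ∈ Metric.closedBall (0 : EuclideanSpace ℂ (Fin d)) 1,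
      SchattenTuple.MemSchatten p (SchattenTuple.combo z T) ∧
      ∀ θ : ℝ, SchattenTuple.MemSchatten p
        ((ℜ (Complex.exp (θ * Complex.I) • SchattenTuple.combo z T) : H →L[ℂ] H))) ∧
    SchattenTuple.jointSchattenNumRadius p T < ∞ ∧
    SchattenTuple.schattenHypoNorm p T < ∞ ∧
    SchattenTuple.jointSchattenNumRadius p T ≤ SchattenTuple.schattenHypoNorm p T ∧
    SchattenTuple.schattenHypoNorm p T ≤ SchattenTuple.sphericalSchattenNorm p T := by
  have hp0 : 0 ≤ 1 / p := by positivity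
  have hcombo : ∀ z ∈ Metric.closedBall (0 : EuclideanSpace ℂ (Fin d)) 1,
      IsCompactOperator (SchattenTuple.combo z T) ∧
        SchattenTuple.schattenTrace p (SchattenTuple.combo z T) ≤
          SchattenTuple.posTrace (SchattenTuple.tupleModulus T ^ p) := fun z hz =>
    have hz1 : ‖z‖ ≤ 1 := mem_closedBall_zero_iff.1 hz
    have hc := SchattenTuple.isCompactOperator_combo hp hT hz1
    ⟨hc, SchattenTuple.schattenTrace_combo_le hp hz1 hc⟩
  have hhypo : SchattenTuple.schattenHypoNorm p T ≤ SchattenTuple.sphericalSchattenNorm p T :=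
    iSup₂_le fun z hz => ENNReal.rpow_le_rpow (hcombo z hz).2 hp0
  have hradius : SchattenTuple.jointSchattenNumRadius p T ≤ SchattenTuple.schattenHypoNorm p T :=
    iSup₂_mono fun z hz => iSup_le fun θ => ENNReal.rpow_le_rpow
      (SchattenTuple.isCompactOperator_and_schattenTrace_realPart_exp_smul_le hp (hcombo z hz).1 θ).2 hp0
  have hfin : SchattenTuple.sphericalSchattenNorm p T < ∞ :=
    ENNReal.rpow_lt_top_of_nonneg hp0 (ne_of_lt hT)
  refine ⟨fun z hz => ⟨⟨(hcombo z hz).1, (hcombo z hz).2.trans_lt hT⟩, fun θ => ?_⟩,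
    (hradius.trans hhypo).trans_lt hfin, hhypo.trans_lt hfin, hradius, hhypo⟩
  obtain ⟨h1, h2⟩ := SchattenTuple.isCompactOperator_and_schattenTrace_realPart_exp_smul_le hp (hcombo z hz).1 θ
  exact ⟨h1, (h2.trans (hcombo z hz).2).trans_lt hT⟩
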